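/- Let $(x_i,y_i)_{i=1}^N$ be data with $x_i\in\mathbb R^d$, $y_i\in\mathbb R$ (in particular labels in $\{0,1\}$), distributed over $p$ nodes. Put $\ell(y,z)=\log(1+e^z)-yz$. Let $L(w)=\frac1N\sum_{i=1}^N\ell(y_i,x_i^\top w)$ be the global loss. Let $L_k$ be the average of the same terms over the samples of one fixed node $k$ (zero if node $k$ has no samples). For $\alpha>0$, $\lambda\ge 0$ and $\hat w\in\mathbb R^d$ let $$g(w)=L_k(w)+\big(\nabla L(\hat w)-\nabla L_k(\hat w)\big)^\top w+\tfrac{\alpha}{2}\|w-\hat w\|_2^2,\qquad \tilde{\mathcal L}(w)=g(w)+\lambda\|w\|_1$$ be the proximal surrogate loss at $\hat w$ and its smooth part $g$. Fix $\tau>0$, $\beta,\sigma\in(0,1)$, any positive numbers $\eta_0,\eta_1,\dots$, and any starting point $w_0\in\mathbb R^d$. In outer step $s$, newGLMNET with the adaptive inner stopping rule does the following. 1. With $H_s=\nabla^2 g(w_s)$, form the quadratic model $$q_s(\delta)=\nabla g(w_s)^\top\delta+\tfrac12\delta^\top H_s\delta+\lambda\|w_s+\delta\|_1-\lambda\|w_s\|_1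 .$$ 2. Starting at $\delta^0=0$, run cyclic coordinate descent on $q_s$; each pass minimizes $q_s$ exactly over each of the coordinates $1,\dots,d$ in turn. Stop after the first pass $m\ge1$ such that $$\big\|G_\tau\big(w_s+\delta^m,\ \nabla g(w_s)+H_s\delta^m\big)\big\|_2\le\eta_s\,\big\|G_\tau\big(w_s,\nabla g(w_s)\big)\big\|_2,$$ where $G_\tau(v,u)=\tau\big(v-\operatorname{prox}_{(\lambda/\tau)\|\cdot\|_1}(v-u/\tau)\big)$ is the composite gradient, which equals $u$ when $\lambda=0$. Put $\delta_s=\delta^m$. 3. Let $i_s$ be the least $i\ge0$ with $$\tilde{\mathcal L}(w_s+\beta^i\delta_s)-\tilde{\mathcal L}(w_s)\le\sigma\beta^i\big(\nabla g(w_s)^\top\delta_s+\lambda\|w_s+\delta_s\|_1-\lambda\|w_s\|_1\big),$$ and put $w_{s+1}=w_s+\beta^{i_s}\delta_s$. **Theorem.** In every outer step the inner coordinate descent stops after finitely many passes and the line search stops after finitely many trials. The function $\tilde{\mathcal L}$ has a unique minimizer $\tilde w$ on $\mathbb R^d$, and $w_s\to\tilde w$ as $s\to\infty$; that is, newGLMNET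 converges to the exact minimizer of the proximal surrogate loss. -/

import Mathlib

noncomputable section

namespace ProxCSL

/-- The coordinate space `ℝ^d` with its Euclidean norm and inner product. -/
abbrev Vec (d : ℕ) : Type := EuclideanSpace ℝ (Fin d)

/-- The `ℓ¹` norm. -/
def l1 {d : ℕ} (w : Vec d) : ℝ := ∑ j, |w j|

/-- The logistic loss `ℓ(y, z) = log (1 + e^z) - y z`. -/
def logistic (y z : ℝ) : ℝ := Real.log (1 + Real.exp z) - y * z

/-- The average logistic loss over the samples `(x_i, y_i)`, `i ∈ S`, without penalty. -/
def avgLoss {d N : ℕ} (x : Fin N → Vec d) (y : Fin N → ℝ) (S : Finset (Fin N)) (w : Vec d) : ℝ :=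
  (S.card : ℝ)⁻¹ * ∑ i ∈ S, logistic (y i) (inner ℝ (x i) w)

/-- The samples stored on node `k`, when sample `i` is stored on node `node i`. -/
def nodeSamples {N p : ℕ} (node : Fin N → Fin p) (k : Fin p) : Finset (Fin N) :=
  Finset.univ.filter fun i => node i = k

/-- The smooth part of the proximal surrogate loss of node `k` at the estimate `what`:
local logistic loss, plus affine gradient correction, plus proximal term. -/
def smoothSurrogate {d N p : ℕ} (x : Fin N → Vec d) (y : Fin N → ℝ) (node : Fin N → Fin p)
    (k : Fin p) (α : ℝ) (what : Vec d) (w : Vec d) : ℝ :=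
  avgLoss x y (nodeSamples node k) w
    + inner ℝ (gradient (avgLoss x y Finset.univ) what
        - gradient (avgLoss x y (nodeSamples node k)) what) w
    + α / 2 * ‖w - what‖ ^ 2

/-- The proximal surrogate loss, including the penalty `lam * ‖w‖₁`. -/
def surrogate {d N p : ℕ} (x : Fin N → Vec d) (y : Fin N → ℝ) (node : Fin N → Fin p)
    (k : Fin p) (α lam : ℝ) (what : Vec d) (w : Vec d) : ℝ :=
  smoothSurrogate x y node k α what w + lam * l1 w

/-! ### newGLMNET for `min_w g w + lam * ‖w‖₁` -/

/-- The Hessian `∇²g(w)` as a linear map. -/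
def hess {d : ℕ} (g : Vec d → ℝ) (w : Vec d) : Vec d →L[ℝ] Vec d := fderiv ℝ (gradient g) w

/-- The gradient at `δ` of the smooth part `δ ↦ ∇g(w)ᵀδ + ½ δᵀ∇²g(w)δ` of the quadratic model
`q(δ) = ∇g(w)ᵀδ + ½ δᵀ∇²g(w)δ + lam‖w + δ‖₁ - lam‖w‖₁`. -/
def modelGrad {d : ℕ} (g : Vec d → ℝ) (w δ : Vec d) : Vec d := gradient g w + hess g w δ

/-- The minimizer `z` of `G z + ½ h z² + lam |u + z|`, for `h > 0` and `lam ≥ 0`. -/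
def coordMin (lam G h u : ℝ) : ℝ :=
  if G + lam ≤ h * u then -(G + lam) / h
  else if h * u ≤ G - lam then -(G - lam) / h
  else -u

/-- One coordinate step: exact minimization of the quadratic model at `w` over the coordinate
`δ_j`, all other coordinates of `δ` being kept. -/
def coordStep {d : ℕ} (g : Vec d → ℝ) (lam : ℝ) (w δ : Vec d) (j : Fin d) : Vec d :=
  δ + EuclideanSpace.single j
    (coordMin lam (modelGrad g w δ j) (hess g w (EuclideanSpace.single j 1) j) (w j + δ j))

/-- One cyclic coordinate descent pass over the coordinates `0, 1, …, d - 1`. -/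
def cdPass {d : ℕ} (g : Vec d → ℝ) (lam : ℝ) (w δ : Vec d) : Vec d :=
  (List.finRange d).foldl (coordStep g lam w) δ

/-- The inner iterate after `m` coordinate descent passes, starting at `δ = 0`. -/
def cdIter {d : ℕ} (g : Vec d → ℝ) (lam : ℝ) (w : Vec d) (m : ℕ) : Vec d :=
  (cdPass g lam w)^[m] 0

/-- Soft thresholding, the proximal operator of `c‖·‖₁`. -/
def softThreshold {d : ℕ} (c : ℝ) (v : Vec d) : Vec d :=
  WithLp.toLp 2 fun j => max (v j - c) 0 - max (-v j - c) 0

/-- The composite gradient, with scaling `τ > 0`, at the point `v` where the smooth part has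
gradient `G`: `τ (v - prox_{(lam/τ)‖·‖₁}(v - G/τ))`. It is `G` when `lam = 0`. -/
def compositeGrad {d : ℕ} (lam τ : ℝ) (v G : Vec d) : Vec d :=
  τ • (v - softThreshold (lam / τ) (v - τ⁻¹ • G))

/-- The adaptive stopping condition: the composite gradient of the quadratic model at `w + δ`
is at most `η` times the composite gradient of the objective at `w`. -/
def AdaptiveStop {d : ℕ} (g : Vec d → ℝ) (lam τ η : ℝ) (w δ : Vec d) : Prop :=
  ‖compositeGrad lam τ (w + δ) (modelGrad g w δ)‖ ≤ η * ‖compositeGrad lam τ w (gradient g w)‖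

/-- The numbers `m ≥ 1` of inner passes after which the stopping condition holds. -/
def innerStops {d : ℕ} (g : Vec d → ℝ) (lam τ η : ℝ) (w : Vec d) : Set ℕ :=
  {m | 1 ≤ m ∧ AdaptiveStop g lam τ η w (cdIter g lam w m)}

/-- The search direction: the inner iterate at the first pass after which the stopping condition
holds. -/
def direction {d : ℕ} (g : Vec d → ℝ) (lam τ η : ℝ) (w : Vec d) : Vec d :=
  cdIter g lam w (sInf (innerStops g lam τ η w))

/-- The exponents `i` for which the step size `β ^ i` in the direction `δ` gives sufficient
decrease. -/
def lineSearchStops {d : ℕ} (g : Vec d → ℝ) (lam β σ : ℝ) (w δ : Vec d) : Set ℕ :=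
  {i | (g (w + β ^ i • δ) + lam * l1 (w + β ^ i • δ)) - (g w + lam * l1 w)
    ≤ σ * β ^ i * (inner ℝ (gradient g w) δ + lam * l1 (w + δ) - lam * l1 w)}

/-- One outer step: `w + β ^ i δ`, with the first `i` that passes the line search. -/
def outerStep {d : ℕ} (g : Vec d → ℝ) (lam τ η β σ : ℝ) (w : Vec d) : Vec d :=
  w + β ^ sInf (lineSearchStops g lam β σ w (direction g lam τ η w)) • direction g lam τ η w

/-- The outer iterates of newGLMNET from `w₀`, with forcing term `η s` in outer step `s`. -/
def newGLMNET {d : ℕ} (g : Vec d → ℝ) (lam τ : ℝ) (η : ℕ → ℝ) (β σ : ℝ) (w₀ : Vec d) : ℕ → Vec d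
  | 0 => w₀
  | s + 1 => outerStep g lam τ (η s) β σ (newGLMNET g lam τ η β σ w₀ s)

end ProxCSL

end

noncomputable section

namespace ProxCSL

/-! The logistic terms contribute a bounded positive semidefinite Hessian and the proximal term
contributes `α` times the identity. The convergence argument uses only the resulting `StrongSmooth`
bounds.

Let P(w) be the displacement of the first coordinate descent pass at `w`. Exact coordinate
minimization lowers the model by at least `α / 2` times the squared length of the pass, and later
passes never raise it. Hence the direction has model value at most -(α/2)‖P(w)‖², whatever `η` is:
the adaptive rule matters only through `1 ≤ m` and through its termination (`model_direction_le`).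
The line search accepts some exponent bounded uniformly in `w`, so each outer step lowers the
objective by a fixed multiple of ‖P(w)‖² (`objective_outerStep_le`). The objective is bounded below,
so P(w_s) → 0, and the error bound `norm_sub_le_mul_norm_cdPass` turns this into convergence to the
minimizer.

The inner loop stops because pass lengths tend to 0 and bound the composite gradient
(`innerStops_nonempty`). -/

/-- `g` is twice differentiable, with symmetric Hessians that lie between `α` and `L`. -/
structure StrongSmooth {d : ℕ} (g : Vec d → ℝ) (α L : ℝ) : Prop where
  hasGradientAt : ∀ w, HasGradientAt g (gradient g w) w
  hasFDerivAt_gradient : ∀ w, HasFDerivAt (gradient g) (hess g w) w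
  symm : ∀ w u v, inner ℝ (hess g w u) v = inner ℝ u (hess g w v)
  lower : ∀ w u, α * ‖u‖ ^ 2 ≤ inner ℝ (hess g w u) u
  upper : ∀ w, ‖hess g w‖ ≤ L

/-! ### Gradient and Hessian of the surrogate -/

theorem hasDerivAt_log_one_add_exp (z : ℝ) :
    HasDerivAt (fun z => Real.log (1 + Real.exp z)) (Real.sigmoid z) z := by
  have h : 1 + Real.exp z ≠ 0 := by positivity
  have := ((Real.hasDerivAt_exp z).const_add 1).log h
  convert this using 1
  rw [Real.sigmoid_def, Real.exp_neg]
  have := Real.exp_pos z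
  field_simp
  ring

theorem hasDerivAt_logistic (y z : ℝ) :
    HasDerivAt (logistic y) (Real.sigmoid z - y) z := by
  refine ((hasDerivAt_log_one_add_exp z).sub ((hasDerivAt_id z).const_mul y)).congr_deriv ?_
  rw [mul_one]

/-- The gradient of the average logistic loss. -/
def avgLossGrad {d N : ℕ} (x : Fin N → Vec d) (y : Fin N → ℝ) (S : Finset (Fin N)) (w : Vec d) :
    Vec d :=
  (S.card : ℝ)⁻¹ • ∑ i ∈ S, (Real.sigmoid (inner ℝ (x i) w) - y i) • x i

theorem hasGradientAt_avgLoss {d N : ℕ} (x : Fin N → Vec d) (y : Fin N → ℝ)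
    (S : Finset (Fin N)) (w : Vec d) :
    HasGradientAt (avgLoss x y S) (avgLossGrad x y S w) w := by
  rw [hasGradientAt_iff_hasFDerivAt]
  have h : ∀ i ∈ S, HasFDerivAt (fun w => logistic (y i) (inner ℝ (x i) w))
      ((Real.sigmoid (inner ℝ (x i) w) - y i) • innerSL ℝ (x i)) w := fun i _ =>
    (hasDerivAt_logistic (y i) _).comp_hasFDerivAt w (innerSL ℝ (x i)).hasFDerivAt
  refine ((HasFDerivAt.fun_sum h).const_mul (S.card : ℝ)⁻¹).congr_fderiv
    (ContinuousLinearMap.ext fun u => ?_)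
  simp [avgLossGrad]

theorem hasGradientAt_smoothSurrogate {d N p : ℕ} (x : Fin N → Vec d) (y : Fin N → ℝ)
    (node : Fin N → Fin p) (k : Fin p) (α : ℝ) (what w : Vec d) :
    HasGradientAt (smoothSurrogate x y node k α what)
      (avgLossGrad x y (nodeSamples node k) w
        + (gradient (avgLoss x y Finset.univ) what
          - gradient (avgLoss x y (nodeSamples node k)) what)
        + α • (w - what)) w := by
  rw [hasGradientAt_iff_hasFDerivAt]
  have h1 := (hasGradientAt_avgLoss x y (nodeSamples node k) w).hasFDerivAt
  have h2 := (innerSL ℝ (gradient (avgLoss x y Finset.univ) what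
          - gradient (avgLoss x y (nodeSamples node k)) what)).hasFDerivAt (x := w)
  have h3 := (((hasFDerivAt_id w).sub_const what).norm_sq).const_mul (α / 2)
  refine ((h1.add h2).add h3).congr_fderiv (ContinuousLinearMap.ext fun u => ?_)
  simp only [map_add, add_apply, InnerProductSpace.toDual_apply_apply,
    smul_apply, innerSL_apply_apply, map_smul,
    ContinuousLinearMap.comp_apply, ContinuousLinearMap.id_apply, smul_eq_mul, id_eq,
    nsmul_eq_mul, Nat.cast_ofNat]
  ring

theorem hasFDerivAt_avgLossGrad {d N : ℕ} (x : Fin N → Vec d) (y : Fin N → ℝ)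
    (S : Finset (Fin N)) (w : Vec d) :
    HasFDerivAt (avgLossGrad x y S)
      ((S.card : ℝ)⁻¹ • ∑ i ∈ S, (((Real.sigmoid (inner ℝ (x i) w) *
        (1 - Real.sigmoid (inner ℝ (x i) w))) • innerSL ℝ (x i)).smulRight (x i))) w := by
  have h : ∀ i ∈ S, HasFDerivAt
      (fun w => (Real.sigmoid (inner ℝ (x i) w) - y i) • x i)
      (((Real.sigmoid (inner ℝ (x i) w) *
        (1 - Real.sigmoid (inner ℝ (x i) w))) • innerSL ℝ (x i)).smulRight (x i)) w := fun i _ =>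
    (((Real.hasDerivAt_sigmoid _).comp_hasFDerivAt w
      (innerSL ℝ (x i)).hasFDerivAt).sub_const (y i)).smul_const (x i)
  exact (HasFDerivAt.fun_sum h).const_smul (S.card : ℝ)⁻¹

theorem exists_strongSmooth_smoothSurrogate {d N p : ℕ} (x : Fin N → Vec d) (y : Fin N → ℝ)
    (node : Fin N → Fin p) (k : Fin p) {α : ℝ} (hα : 0 < α) (what : Vec d) :
    ∃ L, 0 < L ∧ StrongSmooth (smoothSurrogate x y node k α what) α L := by
  have hgrad := hasGradientAt_smoothSurrogate x y node k α what
  have hfd := fun w => by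
    have := ((hasFDerivAt_avgLossGrad x y (nodeSamples node k) w).add_const
      (gradient (avgLoss x y Finset.univ) what
        - gradient (avgLoss x y (nodeSamples node k)) what)).add
      (((hasFDerivAt_id w).sub_const what).const_smul α)
    exact this.congr_of_eventuallyEq (f₁ := gradient (smoothSurrogate x y node k α what))
      (Filter.Eventually.of_forall fun w => (hgrad w).gradient)
  have hh : ∀ w u, hess (smoothSurrogate x y node k α what) w u
      = ((nodeSamples node k).card : ℝ)⁻¹ • ∑ i ∈ nodeSamples node k,
        (Real.sigmoid (inner ℝ (x i) w) * (1 - Real.sigmoid (inner ℝ (x i) w))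
          * inner ℝ (x i) u) • x i + α • u := by
    intro w u
    rw [hess, (hfd w).fderiv]
    simp [sum_apply]
  have hs : ∀ z, 0 ≤ Real.sigmoid z * (1 - Real.sigmoid z) := fun z =>
    mul_nonneg (Real.sigmoid_nonneg z) (sub_nonneg.2 (Real.sigmoid_le_one z))
  have hs1 : ∀ z, Real.sigmoid z * (1 - Real.sigmoid z) ≤ 1 := fun z => by
    nlinarith [Real.sigmoid_nonneg z, Real.sigmoid_le_one z]
  -- The sigmoid derivative is bounded crudely by 1. On an empty node the inverse cardinality is 0
  -- and the constant is `α`.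
  refine ⟨((nodeSamples node k).card : ℝ)⁻¹ * (∑ i ∈ nodeSamples node k, ‖x i‖ ^ 2) + α,
    by positivity, fun w => ?_, fun w => (hfd w).differentiableAt.hasFDerivAt, fun w u v => ?_,
    fun w u => ?_, fun w => ?_⟩
  · rw [(hgrad w).gradient]
    exact hgrad w
  · simp only [hh, inner_add_left, inner_add_right, real_inner_smul_left, real_inner_smul_right,
      sum_inner, inner_sum]
    congr 2
    refine Finset.sum_congr rfl fun i _ => ?_
    rw [real_inner_comm u (x i)]
    ring
  · simp only [hh, inner_add_left, real_inner_smul_left, sum_inner, real_inner_self_eq_norm_sq]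
    refine le_add_of_nonneg_left (mul_nonneg (by positivity) (Finset.sum_nonneg fun i _ => ?_))
    rw [mul_assoc]
    exact mul_nonneg (hs _) (mul_self_nonneg _)
  · refine ContinuousLinearMap.opNorm_le_bound _ (by positivity) fun u => ?_
    rw [hh, add_mul, mul_assoc, Finset.sum_mul]
    refine (norm_add_le _ _).trans (add_le_add ?_ (by rw [norm_smul, Real.norm_of_nonneg hα.le]))
    rw [norm_smul, Real.norm_of_nonneg (by positivity)]
    refine mul_le_mul_of_nonneg_left
      ((norm_sum_le _ _).trans (Finset.sum_le_sum fun i _ => ?_)) (by positivity)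
    rw [norm_smul, norm_mul, Real.norm_of_nonneg (hs _)]
    have := norm_inner_le_norm (𝕜 := ℝ) (x i) u
    calc _ ≤ 1 * (‖x i‖ * ‖u‖) * ‖x i‖ := by gcongr; exact hs1 _
      _ = _ := by ring

/-! ### First-order consequences of the Hessian bounds -/

namespace StrongSmooth

variable {d : ℕ} {g : Vec d → ℝ} {α L : ℝ}

theorem norm_gradient_sub_le (h : StrongSmooth g α L) (u w : Vec d) :
    ‖gradient g u - gradient g w‖ ≤ L * ‖u - w‖ :=
  Convex.norm_image_sub_le_of_norm_hasFDerivWithin_le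
    (fun z _ => (h.hasFDerivAt_gradient z).hasFDerivWithinAt) (fun z _ => h.upper z)
    convex_univ (Set.mem_univ w) (Set.mem_univ u)

theorem hasDerivAt_line (h : StrongSmooth g α L) (w δ : Vec d) (t : ℝ) :
    HasDerivAt (fun t : ℝ => g (w + t • δ)) (inner ℝ (gradient g (w + t • δ)) δ) t := by
  have h1 : HasDerivAt (fun t : ℝ => w + t • δ) δ t := by
    simpa using ((hasDerivAt_id t).smul_const δ).const_add w
  exact (h.hasGradientAt (w + t • δ)).hasFDerivAt.comp_hasDerivAt t h1

theorem hasDerivAt_gradient_line (h : StrongSmooth g α L) (w δ : Vec d) (t : ℝ) :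
    HasDerivAt (fun t : ℝ => inner ℝ (gradient g (w + t • δ)) δ)
      (inner ℝ (hess g (w + t • δ) δ) δ) t := by
  have h1 : HasDerivAt (fun t : ℝ => w + t • δ) δ t := by
    simpa using ((hasDerivAt_id t).smul_const δ).const_add w
  simpa using ((h.hasFDerivAt_gradient (w + t • δ)).comp_hasDerivAt t h1).inner ℝ
    (hasDerivAt_const t δ)

theorem le_inner_gradient_sub (h : StrongSmooth g α L) (u w : Vec d) :
    α * ‖u - w‖ ^ 2 ≤ inner ℝ (gradient g u - gradient g w) (u - w) := by
  have hd : ∀ t : ℝ, HasDerivAt (fun t : ℝ => inner ℝ (gradient g (w + t • (u - w))) (u - w)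
      - t * (α * ‖u - w‖ ^ 2)) _ t := fun t =>
    (h.hasDerivAt_gradient_line w (u - w) t).sub ((hasDerivAt_id t).mul_const _)
  have hm := monotone_of_deriv_nonneg (fun t => (hd t).differentiableAt) (fun t => by
    rw [(hd t).deriv]; simpa only [one_mul, sub_nonneg] using h.lower _ _) (zero_le_one (α := ℝ))
  simp only [zero_smul, one_smul, add_zero, add_sub_cancel] at hm
  rw [inner_sub_left]
  linarith

theorem add_inner_gradient_le (h : StrongSmooth g α L) (w δ : Vec d) :
    g w + inner ℝ (gradient g w) δ + α / 2 * ‖δ‖ ^ 2 ≤ g (w + δ) := by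
  have hd : ∀ t : ℝ, HasDerivAt (fun t : ℝ => g (w + t • δ) - t * inner ℝ (gradient g w) δ
      - t ^ 2 * (α / 2 * ‖δ‖ ^ 2)) _ t := fun t =>
    ((h.hasDerivAt_line w δ t).sub ((hasDerivAt_id t).mul_const _)).sub
      ((hasDerivAt_pow 2 t).mul_const _)
  have hm := monotoneOn_of_deriv_nonneg (convex_Icc (0 : ℝ) 1)
    (fun t _ => (hd t).continuousAt.continuousWithinAt)
    (fun t _ => (hd t).differentiableAt.differentiableWithinAt) (fun t ht => by
      rw [(hd t).deriv]
      rw [interior_Icc] at ht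
      have := h.le_inner_gradient_sub (w + t • δ) w
      rw [add_sub_cancel_left, inner_sub_left, inner_smul_right, inner_smul_right, norm_smul,
        mul_pow, Real.norm_of_nonneg ht.1.le] at this
      have ht0 := ht.1
      -- Strong monotonicity between `w + t • δ` and `w` carries an extra factor `t`, which is
      -- cancelled; hence the restriction to the open interval.
      have : t * (α * t * ‖δ‖ ^ 2) ≤
          t * (inner ℝ (gradient g (w + t • δ)) δ - inner ℝ (gradient g w) δ) := by linarith
      have := le_of_mul_le_mul_left this ht0
      simp only [Nat.cast_ofNat, Nat.add_one_sub_one, pow_one]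
      linarith) (Set.left_mem_Icc.2 zero_le_one) (Set.right_mem_Icc.2 zero_le_one)
    (zero_le_one (α := ℝ))
  simp only [zero_smul, one_smul, add_zero] at hm
  linarith

/-- Convexity seen from `w + δ`, combined with the Lipschitz gradient. This costs the factor 1/2 on
`L`, which is immaterial here. -/
theorem le_add_inner_gradient (h : StrongSmooth g α L) (hα : 0 ≤ α) (w δ : Vec d) :
    g (w + δ) ≤ g w + inner ℝ (gradient g w) δ + L * ‖δ‖ ^ 2 := by
  have h0 := h.add_inner_gradient_le (w + δ) (-δ)
  have h1 := (real_inner_le_norm (gradient g (w + δ) - gradient g w) δ).trans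
    (mul_le_mul_of_nonneg_right (h.norm_gradient_sub_le (w + δ) w) (norm_nonneg δ))
  rw [inner_sub_left, add_sub_cancel_left] at h1
  rw [inner_neg_right, norm_neg, add_neg_cancel_right] at h0
  nlinarith [mul_nonneg hα (sq_nonneg ‖δ‖)]

end StrongSmooth

/-! ### Subgradients, soft thresholding and the composite gradient -/

/-- `ξ` is a subgradient of `lam * |·|` at `a`. -/
def IsSubgrad (lam a ξ : ℝ) : Prop := ∀ t, lam * |a| + ξ * (t - a) ≤ lam * |t|

theorem isSubgrad_of_pos {lam a : ℝ} (hlam : 0 ≤ lam) (ha : 0 ≤ a) : IsSubgrad lam a lam := by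
  intro t
  rw [abs_of_nonneg ha]
  nlinarith [le_abs_self t]

theorem isSubgrad_of_neg {lam a : ℝ} (hlam : 0 ≤ lam) (ha : a ≤ 0) : IsSubgrad lam a (-lam) := by
  intro t
  rw [abs_of_nonpos ha]
  nlinarith [neg_abs_le t]

theorem isSubgrad_zero {lam ξ : ℝ} (h : |ξ| ≤ lam) : IsSubgrad lam 0 ξ := by
  intro t
  rw [abs_zero, mul_zero, zero_add, sub_zero]
  calc ξ * t ≤ |ξ * t| := le_abs_self _
    _ = |ξ| * |t| := abs_mul _ _
    _ ≤ lam * |t| := by gcongr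

/-- Away from the kink, testing at 0 and at `2 * a` yields the two opposite inequalities that pin
down `ξ`. -/
theorem IsSubgrad.cases {lam a ξ : ℝ} (h : IsSubgrad lam a ξ) :
    (0 < a ∧ ξ = lam) ∨ (a < 0 ∧ ξ = -lam) ∨ (a = 0 ∧ |ξ| ≤ lam) := by
  rcases lt_trichotomy a 0 with ha | ha | ha
  · refine Or.inr (Or.inl ⟨ha, ?_⟩)
    have h1 := h 0
    have h2 := h (2 * a)
    rw [abs_of_neg ha] at h1 h2
    rw [abs_of_neg (by linarith)] at h2
    rw [abs_zero] at h1
    nlinarith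
  · subst ha
    refine Or.inr (Or.inr ⟨rfl, abs_le.2 ?_⟩)
    have h1 := h 1
    have h2 := h (-1)
    simp at h1 h2
    constructor <;> linarith
  · refine Or.inl ⟨ha, ?_⟩
    have h1 := h 0
    have h2 := h (2 * a)
    rw [abs_of_pos ha] at h1 h2
    rw [abs_of_pos (by linarith)] at h2
    rw [abs_zero] at h1
    nlinarith

/-- First-order optimality of the one-dimensional step; the three branches are landing right of,
left of, or on the kink. -/
theorem isSubgrad_coordMin {lam G h u : ℝ} (hlam : 0 ≤ lam) (hh : 0 < h) :
    IsSubgrad lam (u + coordMin lam G h u) (-(G + h * coordMin lam G h u)) := by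
  unfold coordMin
  split_ifs with h1 h2
  · have e : -(G + h * (-(G + lam) / h)) = lam := by field_simp; ring
    rw [e]
    refine isSubgrad_of_pos hlam ?_
    have : u + -(G + lam) / h = (h * u - (G + lam)) / h := by field_simp; ring
    rw [this]
    exact div_nonneg (by linarith) hh.le
  · have e : -(G + h * (-(G - lam) / h)) = -lam := by field_simp; ring
    rw [e]
    refine isSubgrad_of_neg hlam ?_
    have : u + -(G - lam) / h = (h * u - (G - lam)) / h := by field_simp; ring
    rw [this]
    exact div_nonpos_of_nonpos_of_nonneg (by linarith) hh.le
  · rw [add_neg_cancel]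
    exact isSubgrad_zero (abs_le.2 ⟨by linarith, by linarith⟩)

/-- Monotonicity of the subdifferential: the subgradient inequalities at `u` and at the new point
add up to `h z² ≤ 0`. -/
theorem coordMin_eq_zero {lam G h u : ℝ} (hlam : 0 ≤ lam) (hh : 0 < h)
    (hG : IsSubgrad lam u (-G)) : coordMin lam G h u = 0 := by
  have h1 := isSubgrad_coordMin (G := G) (u := u) hlam hh u
  have h2 := hG (u + coordMin lam G h u)
  have : h * coordMin lam G h u ^ 2 ≤ 0 := by linarith
  have : coordMin lam G h u ^ 2 ≤ 0 := nonpos_of_mul_nonpos_right this hh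
  exact pow_eq_zero_iff two_ne_zero |>.1 (le_antisymm this (sq_nonneg _))

/-- The scalar soft thresholding function. -/
def soft (c v : ℝ) : ℝ := max (v - c) 0 - max (-v - c) 0

theorem abs_soft_sub_le {c : ℝ} (hc : 0 ≤ c) (a b : ℝ) : |soft c a - soft c b| ≤ |a - b| := by
  unfold soft
  rcases max_cases (a - c) 0 with h1 | h1 <;> rcases max_cases (-a - c) 0 with h2 | h2 <;>
  rcases max_cases (b - c) 0 with h3 | h3 <;> rcases max_cases (-b - c) 0 with h4 | h4 <;>
  rw [h1.1, h2.1, h3.1, h4.1] <;> rw [abs_le] <;> constructor <;>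
  linarith [neg_abs_le (a - b), le_abs_self (a - b)]

theorem IsSubgrad.soft_eq {lam τ a ξ : ℝ} (hτ : 0 < τ) (hlam : 0 ≤ lam)
    (h : IsSubgrad lam a ξ) : soft (lam / τ) (a + τ⁻¹ * ξ) = a := by
  have hc : 0 ≤ lam / τ := by positivity
  unfold soft
  rcases h.cases with ⟨ha, rfl⟩ | ⟨ha, rfl⟩ | ⟨rfl, hξ⟩
  · rw [max_eq_left, max_eq_right] <;> rw [inv_mul_eq_div] <;> linarith
  · rw [mul_neg, inv_mul_eq_div, max_eq_right, max_eq_left] <;> linarith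
  · have := div_le_div_of_nonneg_right (abs_le.1 hξ).2 hτ.le
    have := div_le_div_of_nonneg_right (abs_le.1 hξ).1 hτ.le
    rw [neg_div] at this
    rw [inv_mul_eq_div, max_eq_right, max_eq_right] <;> linarith

theorem isSubgrad_of_soft_eq {lam τ a ξ : ℝ} (hτ : 0 < τ) (hlam : 0 ≤ lam)
    (h : soft (lam / τ) (a + τ⁻¹ * ξ) = a) : IsSubgrad lam a ξ := by
  have hc : 0 ≤ lam / τ := by positivity
  unfold soft at h
  rw [inv_mul_eq_div] at h
  have key : ∀ {s : ℝ}, ξ / τ = s / τ → ξ = s := fun e => (div_left_inj' hτ.ne').1 e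
  rcases max_cases (a + ξ / τ - lam / τ) 0 with h1 | h1 <;>
  rcases max_cases (-(a + ξ / τ) - lam / τ) 0 with h2 | h2 <;> rw [h1.1, h2.1] at h
  -- Both thresholds can be active only when there is no penalty.
  · have h0 : lam / τ = 0 := by linarith
    have h0 : lam = 0 := by simpa [hτ.ne'] using h0
    subst h0
    have : ξ = 0 := key (by simp only [zero_div] at h h1 h2 ⊢; linarith)
    subst this
    intro t; simp
  · have : ξ = lam := key (by linarith)
    subst this
    exact isSubgrad_of_pos hlam (by linarith)
  · have : ξ = -lam := key (by rw [neg_div]; linarith)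
    subst this
    exact isSubgrad_of_neg hlam (by linarith)
  · have ha : a = 0 := by linarith
    subst ha
    refine isSubgrad_zero (abs_le.2 ⟨?_, ?_⟩)
    · rw [← div_le_div_iff_of_pos_right hτ, neg_div]; linarith
    · rw [← div_le_div_iff_of_pos_right hτ]; linarith

theorem softThreshold_apply {d : ℕ} (c : ℝ) (v : Vec d) (j : Fin d) :
    softThreshold c v j = soft c (v j) := rfl

theorem compositeGrad_apply {d : ℕ} (lam τ : ℝ) (v G : Vec d) (j : Fin d) :
    compositeGrad lam τ v G j = τ * (v j - soft (lam / τ) (v j + τ⁻¹ * (-G j))) := by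
  simp [compositeGrad, softThreshold_apply, sub_eq_add_neg, mul_add]

/-- The subgradient makes `v j` the soft thresholding of `v j - ξ / τ`. Soft thresholding is
1-Lipschitz, and the factors `τ` cancel. -/
theorem abs_compositeGrad_apply_le {d : ℕ} {lam τ ξ : ℝ} (hlam : 0 ≤ lam) (hτ : 0 < τ)
    (v G : Vec d) (j : Fin d) (h : IsSubgrad lam (v j) (-ξ)) :
    |compositeGrad lam τ v G j| ≤ |ξ - G j| := by
  rw [compositeGrad_apply, abs_mul, abs_of_pos hτ]
  nth_rewrite 1 [← h.soft_eq hτ hlam]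
  refine (mul_le_mul_of_nonneg_left (abs_soft_sub_le (by positivity) _ _) hτ.le).trans_eq ?_
  rw [← abs_of_pos hτ, ← abs_mul, abs_of_pos hτ, abs_sub_comm ξ]
  congr 1
  field_simp
  ring

theorem isSubgrad_of_compositeGrad_eq_zero {d : ℕ} {lam τ : ℝ} (hlam : 0 ≤ lam) (hτ : 0 < τ)
    {v G : Vec d} (h : compositeGrad lam τ v G = 0) (j : Fin d) :
    IsSubgrad lam (v j) (-G j) := by
  have h1 := congrArg (fun u : Vec d => u j) h
  simp only [compositeGrad_apply, PiLp.zero_apply, mul_eq_zero, hτ.ne', false_or] at h1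
  exact isSubgrad_of_soft_eq hτ hlam (sub_eq_zero.1 h1).symm

/-! ### The quadratic model and coordinate descent passes -/

/-- The quadratic model of `g + lam * ‖·‖₁` at `w`. -/
def model {d : ℕ} (g : Vec d → ℝ) (lam : ℝ) (w δ : Vec d) : ℝ :=
  inner ℝ (gradient g w) δ + 1 / 2 * inner ℝ (hess g w δ) δ + lam * l1 (w + δ) - lam * l1 w

theorem single_eq_smul {d : ℕ} (j : Fin d) (z : ℝ) :
    EuclideanSpace.single j z = z • (EuclideanSpace.single j 1 : Vec d) := by
  ext i
  by_cases h : i = j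
  · subst h; simp
  · simp [h]

theorem l1_add_single {d : ℕ} (v : Vec d) (j : Fin d) (z : ℝ) :
    l1 (v + EuclideanSpace.single j z) = l1 v + (|v j + z| - |v j|) := by
  unfold l1
  rw [← Finset.add_sum_erase _ _ (Finset.mem_univ j),
    ← Finset.add_sum_erase (a := j) _ (fun j => |v j|) (Finset.mem_univ j)]
  have : ∑ i ∈ Finset.univ.erase j, |(v + EuclideanSpace.single j z) i|
      = ∑ i ∈ Finset.univ.erase j, |v i| := by
    refine Finset.sum_congr rfl fun i hi => ?_
    simp [Finset.ne_of_mem_erase hi]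
  rw [this]
  simp
  ring

namespace StrongSmooth

variable {d : ℕ} {g : Vec d → ℝ} {α L : ℝ}

theorem le_hess_single (h : StrongSmooth g α L) (w : Vec d) (j : Fin d) :
    α ≤ hess g w (EuclideanSpace.single j 1) j := by
  simpa [EuclideanSpace.inner_single_right] using h.lower w (EuclideanSpace.single j 1)

theorem model_add_single (h : StrongSmooth g α L) (lam : ℝ) (w δ : Vec d) (j : Fin d) (z : ℝ) :
    model g lam w (δ + EuclideanSpace.single j z) = model g lam w δ + modelGrad g w δ j * z
      + 1 / 2 * hess g w (EuclideanSpace.single j 1) j * z ^ 2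
      + lam * (|w j + δ j + z| - |w j + δ j|) := by
  have e := single_eq_smul j z
  have hs := h.symm w (EuclideanSpace.single j 1) δ
  unfold model modelGrad
  rw [← add_assoc w, l1_add_single, e]
  simp only [map_add, map_smul, inner_add_left, inner_add_right, real_inner_smul_left,
    real_inner_smul_right, hs]
  simp only [EuclideanSpace.inner_single_right, EuclideanSpace.inner_single_left, PiLp.add_apply,
    conj_trivial, one_mul]
  ring

/-- The curvature along coordinate `j` is at least `α`; testing the new point's subgradient at the
old point leaves half of it as decrease. -/
theorem model_coordStep_le (h : StrongSmooth g α L) (hα : 0 < α) {lam : ℝ} (hlam : 0 ≤ lam)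
    (w δ : Vec d) (j : Fin d) :
    model g lam w (coordStep g lam w δ j)
      ≤ model g lam w δ - α / 2 * ‖coordStep g lam w δ j - δ‖ ^ 2 := by
  have hj := h.le_hess_single w j
  have hsub := isSubgrad_coordMin (G := modelGrad g w δ j) (u := w j + δ j) hlam
    (hα.trans_le hj) (w j + δ j)
  rw [coordStep, add_sub_cancel_left, h.model_add_single, PiLp.norm_single,
    Real.norm_eq_abs, sq_abs]
  nlinarith [sq_nonneg (coordMin lam (modelGrad g w δ j)
    (hess g w (EuclideanSpace.single j 1) j) (w j + δ j))]

theorem isSubgrad_coordStep (h : StrongSmooth g α L) (hα : 0 < α) {lam : ℝ} (hlam : 0 ≤ lam)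
    (w δ : Vec d) (j : Fin d) :
    IsSubgrad lam (w j + coordStep g lam w δ j j) (-modelGrad g w (coordStep g lam w δ j) j) := by
  have hj := h.le_hess_single w j
  have hsub := isSubgrad_coordMin (G := modelGrad g w δ j) (u := w j + δ j) hlam
    (hα.trans_le hj)
  set z := coordMin lam (modelGrad g w δ j)
    (hess g w (EuclideanSpace.single j 1) j) (w j + δ j) with hz
  have e : coordStep g lam w δ j = δ + z • EuclideanSpace.single j 1 := by
    rw [coordStep, single_eq_smul]
  rw [e]
  convert hsub using 1
  · simp; ring
  · simp [modelGrad]; ring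

end StrongSmooth

theorem coordStep_apply_of_ne {d : ℕ} (g : Vec d → ℝ) (lam : ℝ) (w δ : Vec d) {i j : Fin d}
    (hij : i ≠ j) : coordStep g lam w δ j i = δ i := by
  simp [coordStep, hij]

theorem foldl_coordStep_apply_of_notMem {d : ℕ} (g : Vec d → ℝ) (lam : ℝ) (w : Vec d)
    (l : List (Fin d)) (δ : Vec d) {i : Fin d} (hi : i ∉ l) :
    l.foldl (coordStep g lam w) δ i = δ i := by
  induction l generalizing δ with
  | nil => rfl
  | cons j l ih =>
    rw [List.mem_cons, not_or] at hi
    rw [List.foldl_cons, ih _ hi.2, coordStep_apply_of_ne g lam w δ hi.1]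

theorem norm_le_of_abs_apply_le {d : ℕ} {u v : Vec d} (h : ∀ i, |u i| ≤ |v i|) : ‖u‖ ≤ ‖v‖ := by
  rw [EuclideanSpace.norm_eq, EuclideanSpace.norm_eq]
  exact Real.sqrt_le_sqrt (Finset.sum_le_sum fun i _ => by
    simpa only [Real.norm_eq_abs] using pow_le_pow_left₀ (abs_nonneg _) (h i) 2)

namespace StrongSmooth

variable {d : ℕ} {g : Vec d → ℝ} {α L : ℝ}

/-- Without repeated coordinates the single steps are orthogonal, so their squared lengths add up to
that of the whole pass. -/
theorem model_foldl_coordStep_le (h : StrongSmooth g α L) (hα : 0 < α) {lam : ℝ}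
    (hlam : 0 ≤ lam) (w : Vec d) (l : List (Fin d)) (hl : l.Nodup) (δ : Vec d) :
    model g lam w (l.foldl (coordStep g lam w) δ)
      ≤ model g lam w δ - α / 2 * ‖l.foldl (coordStep g lam w) δ - δ‖ ^ 2 := by
  induction l generalizing δ with
  | nil => simp
  | cons j l ih =>
    rw [List.nodup_cons] at hl
    rw [List.foldl_cons]
    have h1 := ih hl.2 (coordStep g lam w δ j)
    have h2 := h.model_coordStep_le hα hlam w δ j
    have h3 := foldl_coordStep_apply_of_notMem g lam w l (coordStep g lam w δ j) hl.1
    set δ' := l.foldl (coordStep g lam w) (coordStep g lam w δ j)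
    have h4 : ‖δ' - δ‖ ^ 2 = ‖δ' - coordStep g lam w δ j‖ ^ 2 + ‖coordStep g lam w δ j - δ‖ ^ 2 := by
      rw [← sub_add_sub_cancel δ' (coordStep g lam w δ j) δ, norm_add_sq_real]
      have : inner ℝ (δ' - coordStep g lam w δ j) (coordStep g lam w δ j - δ) = 0 := by
        nth_rewrite 2 [coordStep]
        rw [add_sub_cancel_left, EuclideanSpace.inner_single_right, PiLp.sub_apply, h3]
        simp
      rw [this]
      ring
    rw [h4]
    linarith

/-- The witness is the iterate just after coordinate `j` is updated. Its `j`-th entry is already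
final, and it differs from the end of the pass only in entries still equal to those of `δ`. -/
theorem exists_isSubgrad_foldl_coordStep (h : StrongSmooth g α L) (hα : 0 < α) {lam : ℝ}
    (hlam : 0 ≤ lam) (w : Vec d) (l : List (Fin d)) (hl : l.Nodup) (δ : Vec d) (j : Fin d)
    (hj : j ∈ l) :
    ∃ ε : Vec d, IsSubgrad lam (w j + l.foldl (coordStep g lam w) δ j) (-modelGrad g w ε j) ∧
      ∀ i, |ε i - l.foldl (coordStep g lam w) δ i| ≤ |l.foldl (coordStep g lam w) δ i - δ i| := by
  induction l generalizing δ with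
  | nil => simp at hj
  | cons k l ih =>
    rw [List.nodup_cons] at hl
    rw [List.foldl_cons]
    have h3 := foldl_coordStep_apply_of_notMem g lam w l (coordStep g lam w δ k) hl.1
    have h5 : ∀ i, |coordStep g lam w δ k i - l.foldl (coordStep g lam w) (coordStep g lam w δ k) i|
        ≤ |l.foldl (coordStep g lam w) (coordStep g lam w δ k) i - δ i| := by
      intro i
      by_cases hi : i = k
      · subst hi
        rw [h3, sub_self, abs_zero]
        exact abs_nonneg _
      · rw [coordStep_apply_of_ne g lam w δ hi, abs_sub_comm]
    rcases List.mem_cons.1 hj with rfl | hj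
    · refine ⟨coordStep g lam w δ j, ?_, h5⟩
      rw [h3]
      exact h.isSubgrad_coordStep hα hlam w δ j
    · obtain ⟨ε, h1, h2⟩ := ih hl.2 (coordStep g lam w δ k) hj
      exact ⟨ε, h1, fun i => (h2 i).trans (by rw [abs_sub_comm]; exact h5 i)⟩

theorem model_cdPass_le (h : StrongSmooth g α L) (hα : 0 < α) {lam : ℝ}
    (hlam : 0 ≤ lam) (w δ : Vec d) :
    model g lam w (cdPass g lam w δ)
      ≤ model g lam w δ - α / 2 * ‖cdPass g lam w δ - δ‖ ^ 2 :=
  h.model_foldl_coordStep_le hα hlam w _ (List.nodup_finRange d) δ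

/-- After a pass, the model at `w` has a coordinatewise subgradient residual that is bounded by
the length of the pass. -/
theorem exists_isSubgrad_cdPass (h : StrongSmooth g α L) (hα : 0 < α) {lam : ℝ}
    (hlam : 0 ≤ lam) (w δ : Vec d) (j : Fin d) :
    ∃ r : ℝ, IsSubgrad lam ((w + cdPass g lam w δ) j) (-r) ∧
      |r - modelGrad g w (cdPass g lam w δ) j| ≤ L * ‖cdPass g lam w δ - δ‖ := by
  obtain ⟨ε, h1, h2⟩ := h.exists_isSubgrad_foldl_coordStep hα hlam w _
    (List.nodup_finRange d) δ j (List.mem_finRange j)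
  refine ⟨modelGrad g w ε j, h1, ?_⟩
  have h3 : ‖ε - cdPass g lam w δ‖ ≤ ‖cdPass g lam w δ - δ‖ := norm_le_of_abs_apply_le h2
  have h4 : modelGrad g w ε - modelGrad g w (cdPass g lam w δ)
      = hess g w (ε - cdPass g lam w δ) := by simp [modelGrad]
  calc _ = ‖(modelGrad g w ε - modelGrad g w (cdPass g lam w δ)) j‖ := rfl
    _ ≤ ‖hess g w (ε - cdPass g lam w δ)‖ := by rw [h4]; exact PiLp.norm_apply_le _ j
    _ ≤ ‖hess g w‖ * ‖ε - cdPass g lam w δ‖ := ContinuousLinearMap.le_opNorm _ _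
    _ ≤ _ := mul_le_mul (h.upper w) h3 (norm_nonneg _) ((norm_nonneg _).trans (h.upper w))

end StrongSmooth

/-! ### Convexity of the penalty and a telescoping lemma -/

theorem l1_nonneg {d : ℕ} (w : Vec d) : 0 ≤ l1 w := Finset.sum_nonneg fun _ _ => abs_nonneg _

theorem continuous_l1 {d : ℕ} : Continuous (l1 : Vec d → ℝ) := by
  unfold l1
  fun_prop

theorem l1_add_smul_le {d : ℕ} (w δ : Vec d) {t : ℝ} (ht : 0 ≤ t) (ht1 : t ≤ 1) :
    l1 (w + t • δ) ≤ l1 w + t * (l1 (w + δ) - l1 w) := by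
  unfold l1
  rw [← Finset.sum_sub_distrib, Finset.mul_sum, ← Finset.sum_add_distrib]
  refine Finset.sum_le_sum fun j _ => ?_
  have e : (w + t • δ) j = (1 - t) * w j + t * (w + δ) j := by simp; ring
  calc |(w + t • δ) j| ≤ |(1 - t) * w j| + |t * (w + δ) j| := by rw [e]; exact abs_add_le _ _
    _ = _ := by rw [abs_mul, abs_mul, abs_of_nonneg ht, abs_of_nonneg (sub_nonneg.2 ht1)]; ring

theorem l1_sub_inner_le {d : ℕ} {lam : ℝ} {v r : Vec d}
    (h : ∀ j, IsSubgrad lam (v j) (-r j)) (u : Vec d) :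
    lam * l1 v - inner ℝ r (u - v) ≤ lam * l1 u := by
  have e : inner ℝ r (u - v) = ∑ j, r j * (u j - v j) := by
    simp [PiLp.inner_apply, mul_comm]
  rw [e]
  unfold l1
  rw [Finset.mul_sum, Finset.mul_sum, ← Finset.sum_sub_distrib]
  refine Finset.sum_le_sum fun j _ => ?_
  linarith [h j (u j)]

theorem norm_le_sqrt_mul_of_abs_apply_le {d : ℕ} {v : Vec d} {C : ℝ} (hC : 0 ≤ C)
    (h : ∀ j, |v j| ≤ C) : ‖v‖ ≤ √d * C := by
  refine le_of_sq_le_sq ?_ (by positivity)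
  rw [EuclideanSpace.real_norm_sq_eq, mul_pow, Real.sq_sqrt (Nat.cast_nonneg d)]
  refine (Finset.sum_le_card_nsmul _ _ (C ^ 2) fun j _ => ?_).trans_eq (by simp)
  rw [← sq_abs]
  exact pow_le_pow_left₀ (abs_nonneg _) (h j) 2

/-- Telescoping makes `b` summable. It serves both the inner passes and the outer steps. -/
theorem tendsto_zero_of_le_sub_mul {a b : ℕ → ℝ} {c B : ℝ} (hc : 0 < c) (hb : ∀ n, 0 ≤ b n)
    (hB : ∀ n, B ≤ a n) (h : ∀ n, a (n + 1) ≤ a n - c * b n) :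
    Filter.Tendsto b Filter.atTop (nhds 0) := by
  refine (summable_of_sum_range_le (c := (a 0 - B) / c) hb fun n => ?_).tendsto_atTop_zero
  rw [le_div_iff₀' hc]
  have : c * ∑ i ∈ Finset.range n, b i ≤ a 0 - a n := by
    induction n with
    | zero => simp
    | succ n ih =>
      rw [Finset.sum_range_succ, mul_add]
      linarith [h n]
  linarith [hB n]

theorem cdIter_succ {d : ℕ} (g : Vec d → ℝ) (lam : ℝ) (w : Vec d) (m : ℕ) :
    cdIter g lam w (m + 1) = cdPass g lam w (cdIter g lam w m) :=
  Function.iterate_succ_apply' _ _ _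

theorem model_zero {d : ℕ} (g : Vec d → ℝ) (lam : ℝ) (w : Vec d) : model g lam w 0 = 0 := by
  simp [model]

/-- The predicted decrease `∇g(w)ᵀδ + lam‖w + δ‖₁ - lam‖w‖₁` of the line search. -/
def predDecrease {d : ℕ} (g : Vec d → ℝ) (lam : ℝ) (w δ : Vec d) : ℝ :=
  inner ℝ (gradient g w) δ + lam * l1 (w + δ) - lam * l1 w

/-! ### Termination of the inner loop -/

namespace StrongSmooth

variable {d : ℕ} {g : Vec d → ℝ} {α L lam : ℝ}

theorem cdPass_zero_eq_zero (h : StrongSmooth g α L) (hα : 0 < α) (hlam : 0 ≤ lam) {w : Vec d}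
    (hw : ∀ j, IsSubgrad lam (w j) (-gradient g w j)) : cdPass g lam w 0 = 0 := by
  unfold cdPass
  generalize List.finRange d = l
  induction l with
  | nil => rfl
  | cons j l ih =>
    rw [List.foldl_cons]
    have : coordStep g lam w 0 j = 0 := by
      have hj := h.le_hess_single w j
      have e : coordMin lam (modelGrad g w 0 j) (hess g w (EuclideanSpace.single j 1) j)
          (w j + (0 : Vec d) j) = 0 :=
        coordMin_eq_zero hlam (hα.trans_le hj) (by simpa [modelGrad] using hw j)
      rw [coordStep, e, single_eq_smul, zero_smul, add_zero]
    rw [this, ih]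

theorem model_cdIter_succ_le (h : StrongSmooth g α L) (hα : 0 < α) (hlam : 0 ≤ lam) (w : Vec d)
    (m : ℕ) : model g lam w (cdIter g lam w (m + 1)) ≤ model g lam w (cdIter g lam w m)
      - α / 2 * ‖cdIter g lam w (m + 1) - cdIter g lam w m‖ ^ 2 := by
  rw [cdIter_succ]
  exact h.model_cdPass_le hα hlam w _

/-- Only the decrease of the first pass is kept, so the bound does not depend on when the inner loop
stops. -/
theorem model_cdIter_le (h : StrongSmooth g α L) (hα : 0 < α) (hlam : 0 ≤ lam) (w : Vec d)
    {m : ℕ} (hm : 1 ≤ m) :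
    model g lam w (cdIter g lam w m) ≤ -(α / 2 * ‖cdPass g lam w 0‖ ^ 2) := by
  induction m, hm using Nat.le_induction with
  | base =>
    have := h.model_cdPass_le hα hlam w 0
    rwa [model_zero, sub_zero, zero_sub] at this
  | succ m _ ih =>
    have := h.model_cdIter_succ_le hα hlam w m
    have : 0 ≤ α / 2 * ‖cdIter g lam w (m + 1) - cdIter g lam w m‖ ^ 2 := by positivity
    linarith

theorem le_model (h : StrongSmooth g α L) (hα : 0 < α) (hlam : 0 ≤ lam) (w δ : Vec d) :
    -(‖gradient g w‖ ^ 2 / (2 * α)) - lam * l1 w ≤ model g lam w δ := by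
  have h1 := h.lower w δ
  have h2 := neg_le_of_abs_le (abs_real_inner_le_norm (gradient g w) δ)
  have h3 := mul_nonneg hlam (l1_nonneg (w + δ))
  have h4 : ‖gradient g w‖ * ‖δ‖ ≤ ‖gradient g w‖ ^ 2 / (2 * α) + α / 2 * ‖δ‖ ^ 2 := by
    have : ‖gradient g w‖ ^ 2 / (2 * α) + α / 2 * ‖δ‖ ^ 2 - ‖gradient g w‖ * ‖δ‖
        = (‖gradient g w‖ - α * ‖δ‖) ^ 2 / (2 * α) := by field_simp; ring
    have : 0 ≤ (‖gradient g w‖ - α * ‖δ‖) ^ 2 / (2 * α) := by positivity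
    linarith
  unfold model
  linarith

/-- The passes of cyclic coordinate descent become arbitrarily short. -/
theorem tendsto_norm_cdIter_sub (h : StrongSmooth g α L) (hα : 0 < α) (hlam : 0 ≤ lam)
    (w : Vec d) :
    Filter.Tendsto (fun m => ‖cdIter g lam w (m + 1) - cdIter g lam w m‖) Filter.atTop
      (nhds 0) := by
  have := tendsto_zero_of_le_sub_mul (half_pos hα) (fun m => by positivity)
    (fun m => h.le_model hα hlam w (cdIter g lam w m)) (h.model_cdIter_succ_le hα hlam w)
  simpa using this.sqrt

theorem norm_compositeGrad_cdPass_le (h : StrongSmooth g α L) (hα : 0 < α) (hL : 0 ≤ L)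
    (hlam : 0 ≤ lam) {τ : ℝ} (hτ : 0 < τ) (w δ : Vec d) :
    ‖compositeGrad lam τ (w + cdPass g lam w δ) (modelGrad g w (cdPass g lam w δ))‖
      ≤ √d * (L * ‖cdPass g lam w δ - δ‖) := by
  refine norm_le_sqrt_mul_of_abs_apply_le (by positivity) fun j => ?_
  obtain ⟨r, h1, h2⟩ := h.exists_isSubgrad_cdPass hα hlam w δ j
  exact (abs_compositeGrad_apply_le hlam hτ _ _ j h1).trans h2

/-- A positive threshold is reached because pass lengths vanish. A zero threshold means `w` is
stationary, and then the first pass does not move. -/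
theorem innerStops_nonempty (h : StrongSmooth g α L) (hα : 0 < α) (hL : 0 ≤ L)
    (hlam : 0 ≤ lam) {τ η : ℝ} (hτ : 0 < τ) (hη : 0 < η) (w : Vec d) :
    (innerStops g lam τ η w).Nonempty := by
  by_cases h0 : compositeGrad lam τ w (gradient g w) = 0
  · have hw := isSubgrad_of_compositeGrad_eq_zero hlam hτ h0
    refine ⟨1, le_rfl, ?_⟩
    have e : cdIter g lam w 1 = 0 := h.cdPass_zero_eq_zero hα hlam hw
    rw [AdaptiveStop, e, modelGrad, map_zero, add_zero, add_zero, h0]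
    simp
  · have hpos : 0 < η * ‖compositeGrad lam τ w (gradient g w)‖ :=
      mul_pos hη (norm_pos_iff.2 h0)
    have ht := ((h.tendsto_norm_cdIter_sub hα hlam w).const_mul L).const_mul √d
    rw [mul_zero, mul_zero] at ht
    obtain ⟨m, hm⟩ := (ht.eventually (gt_mem_nhds hpos)).exists
    refine ⟨m + 1, Nat.le_add_left 1 m, ?_⟩
    rw [cdIter_succ] at hm
    rw [AdaptiveStop, cdIter_succ]
    exact (h.norm_compositeGrad_cdPass_le hα hL hlam hτ w _).trans hm.le

/-! ### Line search -/

theorem predDecrease_le (h : StrongSmooth g α L) (w δ : Vec d) :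
    predDecrease g lam w δ ≤ model g lam w δ - α / 2 * ‖δ‖ ^ 2 := by
  have := h.lower w δ
  unfold predDecrease model
  linarith

theorem objective_add_smul_le (h : StrongSmooth g α L) (hα : 0 ≤ α) (hlam : 0 ≤ lam)
    (w δ : Vec d) {t : ℝ} (ht : 0 ≤ t) (ht1 : t ≤ 1) :
    g (w + t • δ) + lam * l1 (w + t • δ)
      ≤ g w + lam * l1 w + t * predDecrease g lam w δ + L * t ^ 2 * ‖δ‖ ^ 2 := by
  have h1 := h.le_add_inner_gradient hα w (t • δ)
  have h2 := mul_le_mul_of_nonneg_left (l1_add_smul_le w δ ht ht1) hlam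
  rw [inner_smul_right, norm_smul, mul_pow, Real.norm_of_nonneg ht] at h1
  unfold predDecrease
  linarith

/-- With D the predicted decrease and `t = β ^ i`, acceptance follows from `L t ‖δ‖² ≤ (1 - σ)(-D)`.
A nonpositive model value gives `-D ≥ α / 2 * ‖δ‖ ^ 2`, so the threshold on `i` depends on neither
`w` nor `δ`. -/
theorem mem_lineSearchStops (h : StrongSmooth g α L) (hα : 0 ≤ α) (hlam : 0 ≤ lam)
    {β σ : ℝ} (hβ : 0 < β) (hβ1 : β < 1) (hσ1 : σ < 1) {w δ : Vec d}
    (hδ : model g lam w δ ≤ 0) {i : ℕ} (hi : L * β ^ i ≤ (1 - σ) * (α / 2)) :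
    i ∈ lineSearchStops g lam β σ w δ := by
  have ht : 0 < β ^ i := by positivity
  have h1 := h.objective_add_smul_le hα hlam w δ ht.le (pow_le_one₀ hβ.le hβ1.le)
  have h2 := h.predDecrease_le (lam := lam) w δ
  have h3 := mul_le_mul_of_nonneg_right hi (sq_nonneg ‖δ‖)
  have h4 : L * β ^ i * ‖δ‖ ^ 2 ≤ (1 - σ) * -predDecrease g lam w δ := by
    rw [mul_assoc (1 - σ)] at h3
    exact h3.trans (mul_le_mul_of_nonneg_left (by linarith) (by linarith))
  have h5 := mul_le_mul_of_nonneg_left h4 ht.le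
  change _ ≤ σ * β ^ i * predDecrease g lam w δ
  linarith

/-! ### The minimizer and the error bound -/

/-- A minimizer of `g + lam * ‖·‖₁` exists. -/
theorem exists_forall_objective_le (h : StrongSmooth g α L) (hα : 0 < α) (hlam : 0 ≤ lam) :
    ∃ u, ∀ v, g u + lam * l1 u ≤ g v + lam * l1 v := by
  have hc : Continuous fun v => g v + lam * l1 v :=
    (continuous_iff_continuousAt.2 fun v => (h.hasGradientAt v).continuousAt).add
      (continuous_l1.const_mul lam)
  refine hc.exists_forall_le ?_
  set b := ‖gradient g 0‖
  refine Filter.tendsto_atTop_mono (fun v => ?_) (Filter.tendsto_atTop_add_const_right _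
    (g 0 - (b + 1) ^ 2 / (2 * α)) (tendsto_norm_cocompact_atTop (E := Vec d)))
  have h1 := h.add_inner_gradient_le 0 v
  rw [zero_add] at h1
  have h2 := neg_le_of_abs_le (abs_real_inner_le_norm (gradient g 0) v)
  have h3 := mul_nonneg hlam (l1_nonneg v)
  -- Using `b + 1` instead of `b` leaves a surplus `‖v‖`, which gives coercivity.
  have h4 : (b + 1) * ‖v‖ ≤ (b + 1) ^ 2 / (2 * α) + α / 2 * ‖v‖ ^ 2 := by
    have : (b + 1) ^ 2 / (2 * α) + α / 2 * ‖v‖ ^ 2 - (b + 1) * ‖v‖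
        = (b + 1 - α * ‖v‖) ^ 2 / (2 * α) := by field_simp; ring
    have : 0 ≤ (b + 1 - α * ‖v‖) ^ 2 / (2 * α) := by positivity
    linarith
  linarith

/-- The variational inequality at a minimizer: were it violated, a short step along `δ` would lower
the objective. -/
theorem predDecrease_nonneg (h : StrongSmooth g α L) (hα : 0 ≤ α) (hL : 0 ≤ L) (hlam : 0 ≤ lam)
    {u : Vec d} (hu : ∀ v, g u + lam * l1 u ≤ g v + lam * l1 v) (δ : Vec d) :
    0 ≤ predDecrease g lam u δ := by
  by_contra! hD
  set D := predDecrease g lam u δ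
  have hM : 0 < L * ‖δ‖ ^ 2 + 1 := by positivity
  -- The step keeps the quadratic term below `-D / 2`; the `+ 1` avoids division by zero.
  set t := min 1 (-D / (2 * (L * ‖δ‖ ^ 2 + 1)))
  have ht : 0 < t := lt_min one_pos (div_pos (by linarith) (by linarith))
  have ht2 : t * (2 * (L * ‖δ‖ ^ 2 + 1)) ≤ -D :=
    (le_div_iff₀ (by linarith)).1 (min_le_right _ _)
  have h1 := h.objective_add_smul_le hα hlam u δ ht.le (min_le_left _ _)
  have h2 := hu (u + t • δ)
  have h3 : t * D + L * t ^ 2 * ‖δ‖ ^ 2 = t * (D + t * (L * ‖δ‖ ^ 2)) := by ring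
  have h4 : 0 ≤ D + t * (L * ‖δ‖ ^ 2) := nonneg_of_mul_nonneg_right (by linarith) ht
  linarith

theorem objective_add_sq_le (h : StrongSmooth g α L) (hα : 0 ≤ α) (hL : 0 ≤ L) (hlam : 0 ≤ lam)
    {u : Vec d} (hu : ∀ v, g u + lam * l1 u ≤ g v + lam * l1 v) (v : Vec d) :
    g u + lam * l1 u + α / 2 * ‖v - u‖ ^ 2 ≤ g v + lam * l1 v := by
  have h1 := h.predDecrease_nonneg hα hL hlam hu (v - u)
  have h2 := h.add_inner_gradient_le u (v - u)
  rw [predDecrease, add_sub_cancel] at h1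
  rw [add_sub_cancel] at h2
  linarith

/-- Error bound: the distance to the minimizer is controlled by the length of the first pass of
coordinate descent. -/
theorem norm_sub_le_mul_norm_cdPass (h : StrongSmooth g α L) (hα : 0 < α) (hL : 0 ≤ L)
    (hlam : 0 ≤ lam) {u : Vec d} (hu : ∀ v, g u + lam * l1 u ≤ g v + lam * l1 v) (w : Vec d) :
    ‖w - u‖ ≤ (1 + (L + 2 * (√d * L + L)) / α) * ‖cdPass g lam w 0‖ := by
  choose r hr1 hr2 using h.exists_isSubgrad_cdPass hα hlam w 0
  rw [sub_zero] at hr2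
  set δ := cdPass g lam w 0
  -- `-R` is a subgradient of the penalty at `w + δ`. `K` collects `√d * L` from the pass residual
  -- and `L` from the change of the model gradient.
  set R : Vec d := WithLp.toLp 2 r
  set K := √d * L + L
  have hK : 0 ≤ K := by positivity
  have hR : ‖R - gradient g w‖ ≤ K * ‖δ‖ := by
    have h1 : ‖R - modelGrad g w δ‖ ≤ √d * (L * ‖δ‖) :=
      norm_le_sqrt_mul_of_abs_apply_le (by positivity) hr2
    have h2 : ‖modelGrad g w δ - gradient g w‖ ≤ L * ‖δ‖ := by
      rw [modelGrad, add_sub_cancel_left]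
      exact ((hess g w).le_opNorm δ).trans
        (mul_le_mul_of_nonneg_right (h.upper w) (norm_nonneg _))
    calc _ ≤ ‖R - modelGrad g w δ‖ + ‖modelGrad g w δ - gradient g w‖ :=
          norm_sub_le_norm_sub_add_norm_sub _ _ _
      _ ≤ _ := by linarith
  -- The subgradient at `w + δ` is tested at `u` and the variational inequality at `u` is tested at
  -- `w + δ`; in the sum the penalties cancel.
  have h1 := l1_sub_inner_le (r := R) hr1 u
  have h2 := h.predDecrease_nonneg hα.le hL hlam hu (w + δ - u)
  rw [predDecrease, add_sub_cancel] at h2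
  have h3 := h.le_inner_gradient_sub w u
  have h4 := (real_inner_le_norm (gradient g u - gradient g w) δ).trans
    (mul_le_mul_of_nonneg_right ((norm_sub_rev _ _).trans_le (h.norm_gradient_sub_le w u))
      (norm_nonneg δ))
  have h5 := (real_inner_le_norm (R - gradient g w) (u - (w + δ))).trans
    (mul_le_mul_of_nonneg_right hR (norm_nonneg _))
  have h6 : ‖u - (w + δ)‖ ≤ ‖w - u‖ + ‖δ‖ := by
    rw [show u - (w + δ) = -((w - u) + δ) by abel, norm_neg]
    exact norm_add_le _ _
  have h7 := mul_le_mul_of_nonneg_left h6 (mul_nonneg hK (norm_nonneg δ))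
  have h8 : α * ‖w - u‖ ^ 2 ≤ L * ‖w - u‖ * ‖δ‖ + K * ‖δ‖ * (‖w - u‖ + ‖δ‖) := by
    simp only [inner_sub_left, inner_sub_right, inner_add_right] at h1 h2 h3 h4 h5
    linarith
  rw [add_mul, one_mul]
  have hb := norm_nonneg δ
  -- The first case accounts for the 1 in the constant. In the second, `‖δ‖` is the smaller length,
  -- so `K‖δ‖(‖w - u‖ + ‖δ‖)` is at most `2K‖δ‖‖w - u‖`, and `‖w - u‖` cancels.
  rcases le_or_gt ‖w - u‖ ‖δ‖ with hab | hab
  · exact hab.trans (le_add_of_nonneg_right (by positivity))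
  · have ha : 0 < ‖w - u‖ := hb.trans_lt hab
    have h9 : ‖w - u‖ * (α * ‖w - u‖) ≤ ‖w - u‖ * ((L + 2 * K) * ‖δ‖) := by
      nlinarith [mul_le_mul_of_nonneg_left hab.le (mul_nonneg hK hb)]
    have h10 := le_of_mul_le_mul_left h9 ha
    rw [← le_div_iff₀' hα, mul_div_right_comm] at h10
    linarith

/-! ### Descent of the outer iteration and convergence -/

theorem model_direction_le (h : StrongSmooth g α L) (hα : 0 < α) (hL : 0 ≤ L)
    (hlam : 0 ≤ lam) {τ η : ℝ} (hτ : 0 < τ) (hη : 0 < η) (w : Vec d) :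
    model g lam w (direction g lam τ η w) ≤ -(α / 2 * ‖cdPass g lam w 0‖ ^ 2) :=
  h.model_cdIter_le hα hlam w (Nat.sInf_mem (h.innerStops_nonempty hα hL hlam hτ hη w)).1

theorem model_direction_nonpos (h : StrongSmooth g α L) (hα : 0 < α) (hL : 0 ≤ L)
    (hlam : 0 ≤ lam) {τ η : ℝ} (hτ : 0 < τ) (hη : 0 < η) (w : Vec d) :
    model g lam w (direction g lam τ η w) ≤ 0 :=
  (h.model_direction_le hα hL hlam hτ hη w).trans (neg_nonpos.2 (by positivity))

theorem objective_outerStep_le (h : StrongSmooth g α L) (hα : 0 < α) (hL : 0 ≤ L)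
    (hlam : 0 ≤ lam) {τ η β σ : ℝ} (hτ : 0 < τ) (hη : 0 < η) (hβ : 0 < β) (hβ1 : β < 1)
    (hσ : 0 < σ) (hσ1 : σ < 1) {i : ℕ} (hi : L * β ^ i ≤ (1 - σ) * (α / 2)) (w : Vec d) :
    g (outerStep g lam τ η β σ w) + lam * l1 (outerStep g lam τ η β σ w)
      ≤ g w + lam * l1 w - σ * β ^ i * (α / 2) * ‖cdPass g lam w 0‖ ^ 2 := by
  have hm := h.model_direction_le hα hL hlam hτ hη w
  have hmem := h.mem_lineSearchStops hα.le hlam hβ hβ1 hσ1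
    (h.model_direction_nonpos hα hL hlam hτ hη w) hi
  have h1 := Nat.sInf_mem ⟨i, hmem⟩
  have h2 := Nat.sInf_le hmem
  unfold outerStep
  set δ := direction g lam τ η w
  set k := sInf (lineSearchStops g lam β σ w δ)
  replace h1 : (g (w + β ^ k • δ) + lam * l1 (w + β ^ k • δ)) - (g w + lam * l1 w)
    ≤ σ * β ^ k * predDecrease g lam w δ := h1
  have h3 : predDecrease g lam w δ ≤ -(α / 2 * ‖cdPass g lam w 0‖ ^ 2) := by
    have := h.predDecrease_le (lam := lam) w δ
    have : 0 ≤ α / 2 * ‖δ‖ ^ 2 := by positivity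
    linarith
  -- The search takes the least admissible exponent, so its step is no shorter than the uniform one.
  have h4 : β ^ i ≤ β ^ k := pow_le_pow_of_le_one hβ.le hβ1.le h2
  have h5 : σ * β ^ k * predDecrease g lam w δ
      ≤ σ * β ^ k * -(α / 2 * ‖cdPass g lam w 0‖ ^ 2) :=
    mul_le_mul_of_nonneg_left h3 (by positivity)
  have h6 : σ * β ^ i * (α / 2 * ‖cdPass g lam w 0‖ ^ 2)
      ≤ σ * β ^ k * (α / 2 * ‖cdPass g lam w 0‖ ^ 2) := by gcongr
  linarith

theorem exists_mul_pow_le (hα : 0 < α) (hL : 0 < L) {β σ : ℝ} (hβ1 : β < 1) (hσ1 : σ < 1) :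
    ∃ i : ℕ, L * β ^ i ≤ (1 - σ) * (α / 2) := by
  obtain ⟨i, hi⟩ := exists_pow_lt_of_lt_one
    (show 0 < (1 - σ) * (α / 2) / L from div_pos (mul_pos (by linarith) (by linarith)) hL) hβ1
  exact ⟨i, by rw [← le_div_iff₀' hL]; exact hi.le⟩

theorem tendsto_newGLMNET (h : StrongSmooth g α L) (hα : 0 < α) (hL : 0 < L)
    (hlam : 0 ≤ lam) {τ β σ : ℝ} {η : ℕ → ℝ} (hτ : 0 < τ) (hη : ∀ s, 0 < η s) (hβ : 0 < β)
    (hβ1 : β < 1) (hσ : 0 < σ) (hσ1 : σ < 1) {u : Vec d}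
    (hu : ∀ v, g u + lam * l1 u ≤ g v + lam * l1 v) (w₀ : Vec d) :
    Filter.Tendsto (newGLMNET g lam τ η β σ w₀) Filter.atTop (nhds u) := by
  obtain ⟨i, hi⟩ := exists_mul_pow_le hα hL hβ1 hσ1
  have h1 := tendsto_zero_of_le_sub_mul (c := σ * β ^ i * (α / 2)) (by positivity)
    (fun s => by positivity) (fun s => hu (newGLMNET g lam τ η β σ w₀ s))
    (fun s => h.objective_outerStep_le hα hL.le hlam hτ (hη s) hβ hβ1 hσ hσ1 hi _)
  have h2 := h1.sqrt
  simp only [Real.sqrt_sq (norm_nonneg _), Real.sqrt_zero] at h2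
  have h3 := h2.const_mul (1 + (L + 2 * (√d * L + L)) / α)
  rw [mul_zero] at h3
  rw [tendsto_iff_norm_sub_tendsto_zero]
  exact squeeze_zero (fun _ => norm_nonneg _)
    (fun s => h.norm_sub_le_mul_norm_cdPass hα hL.le hlam hu _) h3

end StrongSmooth

end ProxCSL

end

/-- newGLMNET with the adaptive inner stopping rule, run on the proximal surrogate loss: every
inner loop and every line search terminates, and the outer iterates converge to the exact (and
unique) minimizer. -/
theorem mainTheorem1 {d N p : ℕ} (x : Fin N → ProxCSL.Vec d) (y : Fin N → ℝ)
    (node : Fin N → Fin p) (k : Fin p)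
    (α lam : ℝ) (hα : 0 < α) (hlam : 0 ≤ lam) (what : ProxCSL.Vec d)
    (τ β σ : ℝ) (hτ : 0 < τ) (hβ : 0 < β) (hβ1 : β < 1) (hσ : 0 < σ) (hσ1 : σ < 1)
    (η : ℕ → ℝ) (hη : ∀ s, 0 < η s) (w₀ : ProxCSL.Vec d)
    (g : ProxCSL.Vec d → ℝ) (hg : g = ProxCSL.smoothSurrogate x y node k α what)
    (w : ℕ → ProxCSL.Vec d) (hw : w = ProxCSL.newGLMNET g lam τ η β σ w₀) :
    (∀ s, (ProxCSL.innerStops g lam τ (η s) (w s)).Nonempty ∧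
      (ProxCSL.lineSearchStops g lam β σ (w s)
        (ProxCSL.direction g lam τ (η s) (w s))).Nonempty) ∧
    ∃ wtilde : ProxCSL.Vec d,
      (∀ v, v ≠ wtilde → ProxCSL.surrogate x y node k α lam what wtilde
        < ProxCSL.surrogate x y node k α lam what v) ∧
      Filter.Tendsto w Filter.atTop (nhds wtilde) := by
  subst hg hw
  obtain ⟨L, hL, h⟩ := ProxCSL.exists_strongSmooth_smoothSurrogate x y node k hα what
  obtain ⟨i, hi⟩ := ProxCSL.StrongSmooth.exists_mul_pow_le hα hL hβ1 hσ1
  obtain ⟨u, hu⟩ := h.exists_forall_objective_le hα hlam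
  refine ⟨fun s => ⟨h.innerStops_nonempty hα hL.le hlam hτ (hη s) _, i,
    h.mem_lineSearchStops hα.le hlam hβ hβ1 hσ1
      (h.model_direction_nonpos hα hL.le hlam hτ (hη s) _) hi⟩, u, fun v hv => ?_,
    h.tendsto_newGLMNET hα hL hlam hτ hη hβ hβ1 hσ hσ1 hu w₀⟩
  -- Quadratic growth around `u` gives strictness, hence uniqueness.
  refine lt_of_lt_of_le (lt_add_of_pos_right _ ?_) (h.objective_add_sq_le hα.le hL.le hlam hu v)
  have := norm_pos_iff.2 (sub_ne_zero.2 hv)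
  positivity
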